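/- Notation. For $x\in\{0,1\}^K$ and $1\le \ell\le K$ let $m_\ell(x)=\binom{K}{\ell}^{-1}\sum_{j_1<\dots<j_\ell}x_{j_1}\cdots x_{j_\ell}$. A random vector $x\in\{0,1\}^K$ has distribution $\mathrm{XBern}_K(\mu_1,\dots,\mu_K)$ if it is exchangeable and $\mathbb E[m_\ell(x)]=\mu_\ell$ for $\ell=1,\dots,K$. Let $\beta\in(0,1)$, let $Z_\gamma$ be the $(1-\gamma)$-quantile of the standard Gaussian distribution, and let $x^{(1)},x^{(2)},\dots$ be i.i.d. with distribution $\mathrm{XBern}_K(\mu_1,\dots,\mu_K)$. For each $i$ put $m_1^{(i)}=\frac1K\sum_{j=1}^K x^{(i)}_j$ and $m_{\ell+1}^{(i)}=m_\ell^{(i)}\,\frac{K m_1^{(i)}-\ell}{K-\ell}$ for $1\le\ell<K$, and let $\hat\mu_\ell=\frac1n\sum_{i=1}^n m_\ell^{(i)}$. From the first $n$ samples, the following algorithms compute $\underline\mu_1\le\overline\mu_1$ (roots are real roots, double roots being allowed; there is no output if a required real root does not exist). First-order Wilson interval: $\underline\mu_1\le\overline\mu_1$ are the roots of $$(n+Z_\beta^2)x^2-(2n\hat\mu_1+Z_\beta^2)x+n\hat\mu_1^2=0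 .$$ Second-order Wilson interval: with $Z=Z_{\beta/2}$, let $\overline\mu_2$ be the larger root of $(n+Z^2)x^2-(2n\hat\mu_2+Z^2)x+n\hat\mu_2^2=0$; then $\underline\mu_1\le\overline\mu_1$ are the roots of $$(n+Z^2)x^2-\Bigl(2n\hat\mu_1+\frac{Z^2}{K}\Bigr)x+n\hat\mu_1^2-\frac{K-1}{K}Z^2\,\overline\mu_2=0. \qquad (*)$$ Fourth-order Wilson interval: with $Z=Z_{\beta/4}$, for $\ell=3,4$ let $\overline\mu_\ell$ be the larger root of $(n+Z^2)x^2-(2n\hat\mu_\ell+Z^2)x+n\hat\mu_\ell^2=0$; let $\overline\mu_2$ be the larger root of $$\Bigl(n+\frac{2Z^2(2K-3)}{K(K-1)}\Bigr)x^2-\Bigl(2n\hat\mu_2+\frac{2Z^2}{K(K-1)}\Bigr)x+n\hat\mu_2^2-cZ^2=0,\qquad c=\frac{(K-2)(K-3)}{K(K-1)}\bigl(\overline\mu_4-\overline\mu_3^2\bigr)+\frac{4(K-2)}{K(K-1)}\overline\mu_3;$$ then $\underline\mu_1\le\overline\mu_1$ are the roots of $(*)$ with these $Z$ and $\overline\mu_2$.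 Proposition. The outputs satisfy $$\lim_{n\to\infty}\mathbb P(\underline\mu_1\le\mu_1)\ge 1-\beta,\qquad \lim_{n\to\infty}\mathbb P(\mu_1\le\overline\mu_1)\ge 1-\beta,\qquad \lim_{n\to\infty}\mathbb P(\underline\mu_1\le\mu_1\le\overline\mu_1)\ge 1-C\beta,$$ where the limits exist and each event includes that the algorithm has an output, provided that (a) $K\ge1$ and $C=2$, for the first-order interval; (b) $K\ge2$ and $C=3/2$, for the second-order interval; (c) $K\ge4$ and $C=5/4$, for the fourth-order interval. -/

import Mathlib

open MeasureTheory ProbabilityTheory Filter Topology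

noncomputable section

namespace Wilson

/-- The `j`-th coordinate of a vector in `{0,1}^K`, as a real number. -/
def coord {K : ℕ} (x : Fin K → Fin 2) (j : Fin K) : ℝ := ((x j : ℕ) : ℝ)

/-- `m_ℓ(x) = (1 / binom K ℓ) * ∑_{j₁ < ⋯ < j_ℓ} x_{j₁} ⋯ x_{j_ℓ}`. -/
def momentStat {K : ℕ} (ℓ : ℕ) (x : Fin K → Fin 2) : ℝ :=
  (1 / (K.choose ℓ : ℝ)) *
    ∑ s ∈ Finset.powersetCard ℓ (Finset.univ : Finset (Fin K)), ∏ j ∈ s, coord x j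

/-- The random vector `X` in `{0,1}^K` has the exchangeable Bernoulli distribution
`XBern_K(m 1, …, m K)` (the other values of `m` play no role). -/
structure IsXBern {Ω : Type*} [MeasurableSpace Ω] (P : Measure Ω) {K : ℕ}
    (X : Ω → Fin K → Fin 2) (m : ℕ → ℝ) : Prop where
  aemeasurable : AEMeasurable X P
  exchangeable : ∀ π : Equiv.Perm (Fin K), IdentDistrib X (fun ω j => X ω (π j)) P P
  moments : ∀ ℓ ∈ Finset.Icc 1 K, ∫ ω, momentStat ℓ (X ω) ∂P = m ℓ

/-- `Z_β`: the `(1 - β)`-quantile of the standard Gaussian distribution. -/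
def gaussQuantile (β : ℝ) : ℝ := sInf {t : ℝ | 1 - β ≤ cdf (gaussianReal 0 1) t}

/-- The sample mean `m₁ = (1/K) ∑_j x_j` of one vector. -/
def sampleMean {K : ℕ} (x : Fin K → Fin 2) : ℝ := (1 / (K : ℝ)) * ∑ j, coord x j

/-- The statistics computed by the algorithms:
`m₁` is the mean and `m_{ℓ+1} = m_ℓ (K m₁ - ℓ) / (K - ℓ)` for `ℓ ≥ 1`. -/
def algMoment {K : ℕ} (x : Fin K → Fin 2) : ℕ → ℝ
  | 0 => 1
  | 1 => sampleMean x
  | ℓ + 2 => algMoment x (ℓ + 1) *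
      (((K : ℝ) * sampleMean x - ((ℓ + 1 : ℕ) : ℝ)) / ((K : ℝ) - ((ℓ + 1 : ℕ) : ℝ)))

/-- The empirical moment `μ̂_ℓ = (1/n) ∑_i m_ℓ^{(i)}`. -/
def empMoment {K n : ℕ} (x : Fin n → Fin K → Fin 2) (ℓ : ℕ) : ℝ :=
  (1 / (n : ℝ)) * ∑ i, algMoment (x i) ℓ

/-- `r` is the larger real root of `a x² - b x + c` (a double root is allowed). -/
def IsLargerRoot (a b c r : ℝ) : Prop := IsGreatest {x : ℝ | a * x ^ 2 - b * x + c = 0} r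

/-- `r` is the smaller real root of `a x² - b x + c` (a double root is allowed). -/
def IsSmallerRoot (a b c r : ℝ) : Prop := IsLeast {x : ℝ | a * x ^ 2 - b * x + c = 0} r

/-- `L, U` is the output of the first-order Wilson algorithm on the samples `x`.
As for the two other algorithms, there is no output if a required real root does not exist. -/
def FirstOrderOutput (β : ℝ) {K n : ℕ} (x : Fin n → Fin K → Fin 2) (L U : ℝ) : Prop :=
  let Z := gaussQuantile β
  let a := n + Z ^ 2
  let b := 2 * n * empMoment x 1 + Z ^ 2
  let c := n * empMoment x 1 ^ 2
  IsSmallerRoot a b c L ∧ IsLargerRoot a b c U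

/-- The final step shared by the second- and fourth-order algorithms: the two roots `L, U`
of the quadratic for `μ₁`, given the upper confidence bound `u₂` on `μ₂`. -/
def FinalStep (Z : ℝ) {K n : ℕ} (x : Fin n → Fin K → Fin 2) (u₂ L U : ℝ) : Prop :=
  let a := n + Z ^ 2
  let b := 2 * n * empMoment x 1 + Z ^ 2 / K
  let c := n * empMoment x 1 ^ 2 - (((K : ℝ) - 1) / K) * Z ^ 2 * u₂
  IsSmallerRoot a b c L ∧ IsLargerRoot a b c U

/-- `L, U` is the output of the second-order Wilson algorithm on the samples `x`. -/
def SecondOrderOutput (β : ℝ) {K n : ℕ} (x : Fin n → Fin K → Fin 2) (L U : ℝ) : Prop :=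
  let Z := gaussQuantile (β / 2)
  ∃ u₂ : ℝ,
    IsLargerRoot (n + Z ^ 2) (2 * n * empMoment x 2 + Z ^ 2) (n * empMoment x 2 ^ 2) u₂ ∧
    FinalStep Z x u₂ L U

/-- `L, U` is the output of the fourth-order Wilson algorithm on the samples `x`. -/
def FourthOrderOutput (β : ℝ) {K n : ℕ} (x : Fin n → Fin K → Fin 2) (L U : ℝ) : Prop :=
  let Z := gaussQuantile (β / 4)
  let k : ℝ := K
  ∃ u₂ u₃ u₄ : ℝ,
    IsLargerRoot (n + Z ^ 2) (2 * n * empMoment x 3 + Z ^ 2) (n * empMoment x 3 ^ 2) u₃ ∧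
    IsLargerRoot (n + Z ^ 2) (2 * n * empMoment x 4 + Z ^ 2) (n * empMoment x 4 ^ 2) u₄ ∧
    IsLargerRoot
      (n + 2 * Z ^ 2 * (2 * k - 3) / (k * (k - 1)))
      (2 * n * empMoment x 2 + 2 * Z ^ 2 / (k * (k - 1)))
      (n * empMoment x 2 ^ 2 -
        ((k - 2) * (k - 3) / (k * (k - 1)) * (u₄ - u₃ ^ 2) +
          4 * (k - 2) / (k * (k - 1)) * u₃) * Z ^ 2)
      u₂ ∧
    FinalStep Z x u₂ L U

/-- The limit of `u` exists and is at least `p`. -/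
def LimAtLeast (u : ℕ → ℝ) (p : ℝ) : Prop := ∃ l : ℝ, Tendsto u atTop (𝓝 l) ∧ p ≤ l

/-- Given the first `n` of the samples `X 0, X 1, …`, the algorithm `Out` returns, with the
asymptotic probabilities `1 - β`, `1 - β` and `1 - C β`, a lower confidence bound `L` for `μ₁`,
an upper confidence bound `U` for `μ₁`, and a confidence interval `[L, U]` for `μ₁`.
Runs in which the algorithm has no output count as failures. -/
def AsymptoticallyValid {Ω : Type*} [MeasurableSpace Ω] (P : Measure Ω) {K : ℕ}
    (X : ℕ → Ω → Fin K → Fin 2)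
    (Out : ∀ n : ℕ, (Fin n → Fin K → Fin 2) → ℝ → ℝ → Prop) (μ₁ β C : ℝ) : Prop :=
  LimAtLeast
    (fun n => P.real {ω | ∃ L U, Out n (fun i => X i ω) L U ∧ L ≤ μ₁}) (1 - β) ∧
  LimAtLeast
    (fun n => P.real {ω | ∃ L U, Out n (fun i => X i ω) L U ∧ μ₁ ≤ U}) (1 - β) ∧
  LimAtLeast
    (fun n => P.real {ω | ∃ L U, Out n (fun i => X i ω) L U ∧ L ≤ μ₁ ∧ μ₁ ≤ U}) (1 - C * β)

end Wilson

end

/-!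
Each interval consists of the roots of a score quadratic `n (x - μ̂₁)² = Z² (B x + c - x²)`, in
which `B x + c - x²` estimates the variance of one sample mean `m₁` when `μ₁ = x`: by the identity
`m₁² = m₁ / K + (K - 1) / K * m₂`, the true variance is `μ₁ / K + (K - 1) / K * E[m₂] - μ₁²`, which
is at most `μ₁ - μ₁²`, the first-order estimate. When the estimate is nonnegative at `μ̂₁`, the
roots exist and enclose `μ̂₁`, so `L ≤ μ₁` means `√n (μ̂₁ - μ₁) ≤ √(Tₙ)` with `Tₙ = Z² (B μ₁ + c -
μ₁²)`, and similarly for `μ₁ ≤ U` and for both (`roots_le_iff`).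

By the strong law of large numbers `Tₙ` converges almost surely to a constant, which is at least
`Z²` times the true variance. The central limit theorem with Slutsky's theorem and the portmanteau
theorem gives the limits of the coverage probabilities (`tendsto_measureReal_clt`); if the variance
is zero, all the events eventually occur almost surely. The limits are at least `1 - γ`, `1 - γ` and
`1 - 2γ`, where `Z = Z_γ` (`asymptoticallyValid_of_eventually_roots`). As the plug-in `ū₂` is
consistent, it costs no coverage in the limit, so `γ = β`, `β / 2`, `β / 4` suffice for the three
algorithms.

It remains to see that the outputs exist. For the first-order interval this is `0 ≤ μ̂₁ ≤ 1`. For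
the others it reduces to `μ̂₂ ≤ ū₂`, by the Cauchy–Schwarz inequality for the empirical mean of
`m₁²`. For the second-order interval `μ̂₂ ≤ ū₂` always holds. For the fourth-order interval it holds
if the variance estimate for `m₂` is nonnegative at `μ̂₂`, which it eventually is, almost surely
(`fourthOrder_variance_nonneg`): either `E[m₃] < E[m₂]`, and then `ū₃ ≤ μ̂₂` eventually by
consistency, or `m₂ = m₃ = m₄` almost surely, and then the empirical moments of orders two to four
coincide.
-/

noncomputable section

namespace Wilson

/-! ### Roots of real quadratics -/

/-- The expression `(b + √(b² - 4ac)) / (2a)` for the larger root of `a x² - b x + c`. It is the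
larger root when `a > 0` and the discriminant is nonnegative, and a junk value otherwise. -/
def largerRoot (a b c : ℝ) : ℝ := (b + √(b ^ 2 - 4 * a * c)) / (2 * a)

lemma quadratic_eq_mul_sub_mul_sub {a b c : ℝ} (ha : 0 < a) (h : 0 ≤ b ^ 2 - 4 * a * c) (x : ℝ) :
    a * x ^ 2 - b * x + c =
      a * ((x - (b - √(b ^ 2 - 4 * a * c)) / (2 * a)) * (x - largerRoot a b c)) := by
  have hs := Real.sq_sqrt h
  unfold largerRoot
  generalize √(b ^ 2 - 4 * a * c) = s at hs
  field_simp
  linear_combination hs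

lemma exists_roots {a b c : ℝ} (ha : 0 < a) (h : 0 ≤ b ^ 2 - 4 * a * c) :
    ∃ L, IsSmallerRoot a b c L ∧ IsLargerRoot a b c (largerRoot a b c) ∧
      ∀ x, a * x ^ 2 - b * x + c ≤ 0 ↔ L ≤ x ∧ x ≤ largerRoot a b c := by
  have hfac := quadratic_eq_mul_sub_mul_sub ha h
  set L := (b - √(b ^ 2 - 4 * a * c)) / (2 * a) with hL
  set U := largerRoot a b c with hU
  have hLU : L ≤ U := by
    rw [hL, hU, largerRoot]
    have := Real.sqrt_nonneg (b ^ 2 - 4 * a * c)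
    gcongr
    linarith
  have hroot : ∀ x, a * x ^ 2 - b * x + c = 0 ↔ x = L ∨ x = U := by
    intro x
    rw [hfac, mul_eq_zero, mul_eq_zero, sub_eq_zero, sub_eq_zero]
    simp [ha.ne']
  refine ⟨L, ⟨(hroot L).2 (.inl rfl), fun x hx => ?_⟩, ⟨(hroot U).2 (.inr rfl), fun x hx => ?_⟩,
    fun x => ?_⟩
  · rcases (hroot x).1 hx with rfl | rfl <;> linarith
  · rcases (hroot x).1 hx with rfl | rfl <;> linarith
  · rw [hfac]
    constructor
    · intro hx
      have hx' : (x - L) * (x - U) ≤ 0 := nonpos_of_mul_nonpos_right hx ha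
      constructor <;> by_contra! hlt <;> nlinarith
    · rintro ⟨h1, h2⟩
      exact mul_nonpos_of_nonneg_of_nonpos ha.le
        (mul_nonpos_of_nonneg_of_nonpos (by linarith) (by linarith))

lemma discrim_nonneg_of_nonpos {a b c x : ℝ} (ha : 0 < a) (h : a * x ^ 2 - b * x + c ≤ 0) :
    0 ≤ b ^ 2 - 4 * a * c := by
  nlinarith [sq_nonneg (2 * a * x - b), mul_nonneg ha.le (neg_nonneg.2 h)]

lemma isLargerRoot_largerRoot {a b c x : ℝ} (ha : 0 < a) (h : a * x ^ 2 - b * x + c ≤ 0) :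
    IsLargerRoot a b c (largerRoot a b c) :=
  (exists_roots ha (discrim_nonneg_of_nonpos ha h)).choose_spec.2.1

lemma le_largerRoot {a b c x : ℝ} (ha : 0 < a) (h : a * x ^ 2 - b * x + c ≤ 0) :
    x ≤ largerRoot a b c := by
  obtain ⟨L, -, -, hiff⟩ := exists_roots ha (discrim_nonneg_of_nonpos ha h)
  exact ((hiff x).1 h).2

lemma isLargerRoot_iff_eq {a b c x r : ℝ} (ha : 0 < a) (h : a * x ^ 2 - b * x + c ≤ 0) :
    IsLargerRoot a b c r ↔ r = largerRoot a b c :=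
  ⟨fun hr => hr.unique (isLargerRoot_largerRoot ha h), fun hr => hr ▸ isLargerRoot_largerRoot ha h⟩

/-- After division by `n`, the quadratic degenerates to `(x - p)²`, so its larger root tends to
`p`. -/
lemma tendsto_largerRoot {p d : ℕ → ℝ} {p₀ d₀ : ℝ} (A B : ℝ)
    (hp : Tendsto p atTop (𝓝 p₀)) (hd : Tendsto d atTop (𝓝 d₀)) :
    Tendsto (fun n : ℕ => largerRoot (n + A) (2 * n * p n + B) (n * p n ^ 2 - d n))
      atTop (𝓝 p₀) := by
  have hinv : Tendsto (fun n : ℕ => ((n : ℝ))⁻¹) atTop (𝓝 0) := tendsto_inv_atTop_nhds_zero_nat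
  have ha : Tendsto (fun n : ℕ => 1 + A * (n : ℝ)⁻¹) atTop (𝓝 (1 + A * 0)) :=
    (hinv.const_mul A).const_add 1
  have hb : Tendsto (fun n : ℕ => 2 * p n + B * (n : ℝ)⁻¹) atTop (𝓝 (2 * p₀ + B * 0)) :=
    (hp.const_mul 2).add (hinv.const_mul B)
  have hc : Tendsto (fun n : ℕ => p n ^ 2 - d n * (n : ℝ)⁻¹) atTop (𝓝 (p₀ ^ 2 - d₀ * 0)) :=
    (hp.pow 2).sub (hd.mul hinv)
  have hlim := (hb.add (((hb.pow 2).sub ((ha.const_mul 4).mul hc)).sqrt)).div (ha.const_mul 2)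
    (by norm_num)
  have hval : (2 * p₀ + B * 0 + √((2 * p₀ + B * 0) ^ 2 - 4 * (1 + A * 0) * (p₀ ^ 2 - d₀ * 0))) /
      (2 * (1 + A * 0)) = p₀ := by
    ring_nf
    simp
  rw [hval] at hlim
  refine hlim.congr' ?_
  filter_upwards [eventually_gt_atTop 0] with n hn
  have hn' : (0 : ℝ) < n := by exact_mod_cast hn
  simp only [largerRoot, Pi.div_apply]
  have hdisc : (2 * p n + B * (n : ℝ)⁻¹) ^ 2 -
      4 * (1 + A * (n : ℝ)⁻¹) * (p n ^ 2 - d n * (n : ℝ)⁻¹) =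
      ((2 * n * p n + B) ^ 2 - 4 * (n + A) * (n * p n ^ 2 - d n)) / (n : ℝ) ^ 2 := by
    field_simp
  rw [hdisc, Real.sqrt_div' _ (sq_nonneg _), Real.sqrt_sq hn'.le]
  have h1 : 2 * p n + B * (n : ℝ)⁻¹ = (2 * n * p n + B) / n := by field_simp
  have h2 : 2 * (1 + A * (n : ℝ)⁻¹) = (2 * (n + A)) / n := by field_simp
  rw [h1, h2, ← add_div, div_div_div_cancel_right₀ hn'.ne']

/-- The roots of the score quadratic `n (x - M)² = z (B x + c - x²)` enclose its centre `M` as soon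
as the variance estimate `B x + c - x²` is nonnegative there. A bound `L ≤ μ` or `μ ≤ U` then says
that the one-sided score statistic is at most `√(z (B μ + c - μ²))`. -/
lemma roots_le_iff {n z M B c μ : ℝ} (hn : 0 < n) (hz : 0 ≤ z)
    (hM : 0 ≤ B * M + c - M ^ 2) (hμ : 0 ≤ z * (B * μ + c - μ ^ 2)) :
    ∃ L U, (∀ L' U', IsSmallerRoot (n + z) (2 * n * M + z * B) (n * M ^ 2 - z * c) L' ∧
        IsLargerRoot (n + z) (2 * n * M + z * B) (n * M ^ 2 - z * c) U' ↔ L' = L ∧ U' = U) ∧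
      (L ≤ μ ↔ √n * (M - μ) ≤ √(z * (B * μ + c - μ ^ 2))) ∧
      (μ ≤ U ↔ -(√n * (M - μ)) ≤ √(z * (B * μ + c - μ ^ 2))) := by
  have ha : 0 < n + z := by linarith
  have hq : ∀ x, (n + z) * x ^ 2 - (2 * n * M + z * B) * x + (n * M ^ 2 - z * c) =
      n * (M - x) ^ 2 - z * (B * x + c - x ^ 2) := fun x => by ring
  have hqM : (n + z) * M ^ 2 - (2 * n * M + z * B) * M + (n * M ^ 2 - z * c) ≤ 0 := by
    rw [hq]
    nlinarith [mul_nonneg hz hM]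
  obtain ⟨L, hL, hU, hiff⟩ := exists_roots ha (discrim_nonneg_of_nonpos ha hqM)
  set U := largerRoot (n + z) (2 * n * M + z * B) (n * M ^ 2 - z * c)
  obtain ⟨hLM, hMU⟩ := (hiff M).1 hqM
  set T := z * (B * μ + c - μ ^ 2) with hT
  have hmem : |√n * (M - μ)| ≤ √T ↔ L ≤ μ ∧ μ ≤ U := by
    rw [← hiff, hq, ← hT, Real.le_sqrt (abs_nonneg _) hμ, sq_abs, mul_pow, Real.sq_sqrt hn.le,
      sub_nonpos]
  have hsn : 0 < √n := Real.sqrt_pos.2 hn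
  have hsT : 0 ≤ √T := Real.sqrt_nonneg T
  refine ⟨L, U, fun L' U' => ⟨fun h => ⟨h.1.unique hL, h.2.unique hU⟩, ?_⟩, ?_, ?_⟩
  · rintro ⟨rfl, rfl⟩
    exact ⟨hL, hU⟩
  · rcases le_or_gt M μ with h | h
    · have : √n * (M - μ) ≤ 0 := mul_nonpos_of_nonneg_of_nonpos hsn.le (by linarith)
      exact iff_of_true (by linarith) (by linarith)
    · rw [abs_of_nonneg (mul_nonneg hsn.le (by linarith))] at hmem
      rw [hmem, and_iff_left (by linarith)]
  · rcases le_or_gt μ M with h | h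
    · have : 0 ≤ √n * (M - μ) := mul_nonneg hsn.le (by linarith)
      exact iff_of_true (by linarith) (by linarith)
    · rw [abs_of_nonpos (mul_nonpos_of_nonneg_of_nonpos hsn.le (by linarith))] at hmem
      rw [hmem, and_iff_right (by linarith)]

/-- The bounds that the Wilson upper confidence limit for a proportion `p` satisfies for every
sample size. -/
lemma largerRoot_wilson {n z p : ℝ} (hn : 0 < n) (hz : 0 ≤ z) (hp0 : 0 ≤ p) (hp1 : p ≤ 1) :
    (∀ r, IsLargerRoot (n + z) (2 * n * p + z) (n * p ^ 2) r ↔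
      r = largerRoot (n + z) (2 * n * p + z) (n * p ^ 2)) ∧
    p ≤ largerRoot (n + z) (2 * n * p + z) (n * p ^ 2) ∧
    largerRoot (n + z) (2 * n * p + z) (n * p ^ 2) ≤ 1 := by
  have ha : 0 < n + z := by linarith
  have hq : (n + z) * p ^ 2 - (2 * n * p + z) * p + n * p ^ 2 ≤ 0 := by
    nlinarith [mul_nonneg hz (mul_nonneg hp0 (sub_nonneg.2 hp1))]
  refine ⟨fun r => isLargerRoot_iff_eq ha hq, le_largerRoot ha hq, ?_⟩
  have hroot : (n + z) * _ ^ 2 - (2 * n * p + z) * _ + n * p ^ 2 = 0 :=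
    (isLargerRoot_largerRoot ha hq).1
  set u := largerRoot (n + z) (2 * n * p + z) (n * p ^ 2)
  -- the quadratic equals `n (u - p)² + z u (u - 1)`, which is positive for `u > 1`
  by_contra! hu
  nlinarith [mul_pos hn (pow_pos (show 0 < u - p by linarith) 2),
    mul_nonneg hz (mul_nonneg (show 0 ≤ u by linarith) (show 0 ≤ u - 1 by linarith))]

/-! ### The Gaussian quantile -/

lemma le_cdf_gaussQuantile {γ : ℝ} (h0 : 0 < γ) (h1 : γ < 1) :
    1 - γ ≤ cdf (gaussianReal 0 1) (gaussQuantile γ) := by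
  set S : Set ℝ := {t : ℝ | 1 - γ ≤ cdf (gaussianReal 0 1) t}
  have hne : S.Nonempty := by
    obtain ⟨t, ht⟩ := ((tendsto_cdf_atTop (gaussianReal 0 1)).eventually_const_le
      (show 1 - γ < 1 by linarith)).exists
    exact ⟨t, ht⟩
  obtain ⟨b, hb⟩ := ((tendsto_cdf_atBot (gaussianReal 0 1)).eventually_lt_const
      (show 0 < 1 - γ by linarith)).exists
  have hbdd : BddBelow S :=
    ⟨b, fun t ht => le_of_not_gt fun hlt =>
      (hb.trans_le ht).not_ge (monotone_cdf _ hlt.le)⟩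
  -- the cdf is right-continuous, so the infimum of `S` belongs to `S`
  have hmem : gaussQuantile γ ∈ closure S := csInf_mem_closure hne hbdd
  have hsub : S ⊆ Set.Ici (gaussQuantile γ) := fun t ht => csInf_le hbdd ht
  have hneBot : (𝓝[S] gaussQuantile γ).NeBot := mem_closure_iff_nhdsWithin_neBot.1 hmem
  have htend : Tendsto (cdf (gaussianReal 0 1)) (𝓝[S] gaussQuantile γ)
      (𝓝 (cdf (gaussianReal 0 1) (gaussQuantile γ))) :=
    (((cdf (gaussianReal 0 1)).right_continuous _).mono hsub)
  exact ge_of_tendsto htend (eventually_mem_nhdsWithin.mono fun t ht => ht)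

/-- The algorithms use the quantile only through its square. It is negative for `γ > 1 / 2`, and
replacing it by its absolute value then only raises the probability. -/
lemma le_gaussianReal_Iic_abs {γ : ℝ} (h0 : 0 < γ) (h1 : γ < 1) :
    1 - γ ≤ (gaussianReal 0 1).real (Set.Iic |gaussQuantile γ|) := by
  rw [← cdf_eq_real]
  exact (le_cdf_gaussQuantile h0 h1).trans (monotone_cdf _ (le_abs_self _))

lemma gaussianReal_real_neg_le (z : ℝ) :
    (gaussianReal 0 1).real {x | -x ≤ z} = (gaussianReal 0 1).real (Set.Iic z) := by
  have h : (gaussianReal 0 1).map (fun x => -x) = gaussianReal 0 1 := by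
    simpa using gaussianReal_map_neg (μ := 0) (v := 1)
  conv_rhs => rw [← h]
  rw [map_measureReal_apply measurable_neg measurableSet_Iic]
  rfl

lemma le_gaussianReal_real_abs_le {z γ : ℝ} (h : 1 - γ ≤ (gaussianReal 0 1).real (Set.Iic z)) :
    1 - 2 * γ ≤ (gaussianReal 0 1).real {x | |x| ≤ z} := by
  have h1 : (gaussianReal 0 1).real (Set.Iic z)ᶜ ≤ γ := by
    rw [probReal_compl_eq_one_sub measurableSet_Iic]
    linarith
  have hm : MeasurableSet {x : ℝ | -x ≤ z} := measurableSet_le (by fun_prop) (by fun_prop)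
  have h2 : (gaussianReal 0 1).real {x | -x ≤ z}ᶜ ≤ γ := by
    rw [probReal_compl_eq_one_sub hm, gaussianReal_real_neg_le]
    linarith
  have hm' : MeasurableSet {x : ℝ | |x| ≤ z} := measurableSet_le (by fun_prop) (by fun_prop)
  have h3 : {x : ℝ | |x| ≤ z}ᶜ = (Set.Iic z)ᶜ ∪ {x | -x ≤ z}ᶜ := by
    ext x
    simp [abs_le', imp_iff_not_or]
  have h4 := measureReal_union_le (μ := gaussianReal 0 1) (Set.Iic z)ᶜ {x | -x ≤ z}ᶜ
  rw [← h3, probReal_compl_eq_one_sub hm'] at h4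
  linarith

/-! ### Convergence of probabilities -/

section Convergence

variable {Ω : Type*} [MeasurableSpace Ω] {P : Measure Ω} [IsProbabilityMeasure P]

/-- Sequences of events that almost surely agree from some index on have the same limiting
probabilities. -/
lemma tendsto_measureReal_congr {A B : ℕ → Set Ω} {l : ℝ}
    (hA : ∀ n, NullMeasurableSet (A n) P) (hB : ∀ n, NullMeasurableSet (B n) P)
    (hAB : ∀ᵐ ω ∂P, ∀ᶠ n in atTop, (ω ∈ A n ↔ ω ∈ B n))
    (h : Tendsto (fun n => P.real (B n)) atTop (𝓝 l)) :
    Tendsto (fun n => P.real (A n)) atTop (𝓝 l) := by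
  have hint : ∀ {S : Set Ω}, NullMeasurableSet S P →
      AEStronglyMeasurable (S.indicator (1 : Ω → ℝ)) P := fun hS =>
    aestronglyMeasurable_one.indicator₀ hS
  have hbound : ∀ (S : Set Ω) (ω : Ω), |S.indicator (1 : Ω → ℝ) ω| ≤ 1 := fun S ω => by
    by_cases hω : ω ∈ S <;> simp [hω]
  have hinteg : ∀ {S : Set Ω}, NullMeasurableSet S P →
      Integrable (S.indicator (1 : Ω → ℝ)) P := fun hS =>
    Integrable.of_bound (hint hS) 1 (ae_of_all _ (hbound _))
  have hval : ∀ {S : Set Ω}, NullMeasurableSet S P →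
      ∫ ω, S.indicator (1 : Ω → ℝ) ω ∂P = P.real S := fun hS => by
    rw [integral_indicator₀ hS]
    simp
  have hlim : Tendsto (fun n => ∫ ω, ((A n).indicator (1 : Ω → ℝ) ω -
      (B n).indicator (1 : Ω → ℝ) ω) ∂P) atTop (𝓝 (∫ _, (0 : ℝ) ∂P)) := by
    refine tendsto_integral_of_dominated_convergence (fun _ => 2)
      (fun n => (hint (hA n)).sub (hint (hB n))) (integrable_const _)
      (fun n => ae_of_all _ fun ω => ?_) ?_
    · refine (abs_sub _ _).trans ?_
      linarith [hbound (A n) ω, hbound (B n) ω]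
    · filter_upwards [hAB] with ω hω
      refine tendsto_const_nhds.congr' ?_
      filter_upwards [hω] with n hn
      by_cases h' : ω ∈ B n <;> simp [h', hn]
  simp only [integral_zero] at hlim
  have := hlim.add h
  rw [zero_add] at this
  refine this.congr fun n => ?_
  rw [integral_sub (hinteg (hA n)) (hinteg (hB n)), hval (hA n), hval (hB n)]
  ring

lemma tendsto_measureReal_nonpos_of_tendstoInDistribution {Ω' : Type*} [MeasurableSpace Ω']
    {Q : Measure Ω'} [IsProbabilityMeasure Q] {V : ℕ → Ω → ℝ} {Z : Ω' → ℝ}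
    (h : TendstoInDistribution V atTop Z (fun _ => P) Q) (hnull : Q {ω | Z ω = 0} = 0) :
    Tendsto (fun n => P.real {ω | V n ω ≤ 0}) atTop (𝓝 (Q.real {ω | Z ω ≤ 0})) := by
  have hpre : Q.map Z {0} = 0 := by
    rw [Measure.map_apply_of_aemeasurable h.aemeasurable_limit (measurableSet_singleton 0)]
    exact hnull
  have key := ProbabilityMeasure.tendsto_measure_of_null_frontier_of_tendsto' h.tendsto
    (E := Set.Iic 0) (by rw [frontier_Iic]; exact hpre)
  simp only [ProbabilityMeasure.coe_mk,
    Measure.map_apply_of_aemeasurable h.aemeasurable_limit measurableSet_Iic,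
    Measure.map_apply_of_aemeasurable (h.forall_aemeasurable _) measurableSet_Iic] at key
  exact (ENNReal.tendsto_toReal (measure_ne_top _ _)).comp key

/-- The central limit theorem with a random threshold: if `T n → T` almost surely, the normalized
fluctuation of the sample mean meets `g · ≤ √(T n)` with the probability that a Gaussian variable
of the same variance meets `g · ≤ √T`. -/
lemma tendsto_measureReal_clt {Y : ℕ → Ω → ℝ} {T : ℕ → Ω → ℝ} {T₀ : ℝ} {g : ℝ → ℝ}
    (hY : MemLp (Y 0) 2 P) (hindep : iIndepFun Y P) (hident : ∀ i, IdentDistrib (Y i) (Y 0) P P)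
    (hvar : 0 < Var[Y 0; P])
    (hT : ∀ n, AEMeasurable (T n) P) (hTlim : ∀ᵐ ω ∂P, Tendsto (fun n => T n ω) atTop (𝓝 T₀))
    (hg : Continuous g) (hgabs : ∀ x, |g x| = |x|) :
    Tendsto (fun n : ℕ => P.real
        {ω | g ((√n)⁻¹ * (∑ k ∈ Finset.range n, Y k ω - n * P[Y 0])) ≤ √(T n ω)})
      atTop (𝓝 ((gaussianReal 0 1).real {x | g (√Var[Y 0; P] * x) ≤ √T₀})) := by
  set s := √Var[Y 0; P] with hs
  have hs0 : 0 < s := Real.sqrt_pos.2 hvar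
  have hlaw : HasLaw (fun x => s * x) (gaussianReal 0 Var[Y 0; P].toNNReal)
      (gaussianReal 0 1) := by
    have := gaussianReal_const_mul (P := gaussianReal 0 1) (X := id) (μ := 0) (v := 1)
      ⟨by fun_prop, by simp⟩ s
    convert! this using 2
    · simp
    · ext
      simp [hs, Real.sq_sqrt hvar.le, hvar.le]
  have hclt := tendstoInDistribution_inv_sqrt_mul_sum_sub hlaw hY hindep hident
  have hslutsky := hclt.continuous_comp_prodMk_of_tendstoInMeasure_const
    (g := fun p : ℝ × ℝ => g p.1 - √p.2) (by fun_prop)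
    (tendstoInMeasure_of_tendsto_ae (fun n => (hT n).aestronglyMeasurable) hTlim) hT
  have hnull : gaussianReal 0 1 {x | g (s * x) - √T₀ = 0} = 0 := by
    have hna : NullSingletonClass (gaussianReal 0 1) := nullSingletonClass_gaussianReal one_ne_zero
    refine measure_mono_null (t := {√T₀ / s, -(√T₀ / s)}) (fun x hx => ?_)
      ((Set.toFinite _).measure_zero _)
    have hx' : g (s * x) = √T₀ := sub_eq_zero.1 hx
    have habs : |s * x| = √T₀ := by rw [← hgabs, hx', abs_of_nonneg (Real.sqrt_nonneg _)]
    rcases eq_or_eq_neg_of_abs_eq habs with h | h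
    · left
      rw [eq_div_iff hs0.ne', ← h, mul_comm]
    · right
      rw [Set.mem_singleton_iff, ← neg_div, eq_div_iff hs0.ne', ← h, mul_comm]
  simpa only [sub_nonpos] using
    tendsto_measureReal_nonpos_of_tendstoInDistribution hslutsky hnull

end Convergence

/-! ### Moment statistics of a single vector -/

section Moments

variable {K : ℕ} (x : Fin K → Fin 2)

lemma exists_natCast_eq_mul_sampleMean (hK : K ≠ 0) :
    ∃ s : ℕ, s ≤ K ∧ (K : ℝ) * sampleMean x = s := by
  refine ⟨∑ j, (x j : ℕ), ?_, ?_⟩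
  · calc ∑ j, (x j : ℕ) ≤ ∑ _j : Fin K, 1 := Finset.sum_le_sum fun j _ => by omega
      _ = K := by simp
  · have : (K : ℝ) ≠ 0 := by exact_mod_cast hK
    rw [sampleMean, ← mul_assoc, mul_one_div_cancel this, one_mul]
    simp [coord]

lemma momentStat_one : momentStat 1 x = sampleMean x := by
  simp [momentStat, sampleMean, Finset.powersetCard_one]

lemma algMoment_one : algMoment x 1 = sampleMean x := rfl

lemma algMoment_succ (hK : K ≠ 0) (ℓ : ℕ) :
    algMoment x (ℓ + 1) = algMoment x ℓ * (((K : ℝ) * sampleMean x - ℓ) / ((K : ℝ) - ℓ)) := by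
  cases ℓ with
  | zero =>
    have : (K : ℝ) ≠ 0 := by exact_mod_cast hK
    simp [algMoment, this]
  | succ ℓ => rfl

lemma algMoment_succ_mul {ℓ : ℕ} (hℓ : ℓ < K) :
    algMoment x (ℓ + 1) * ((K : ℝ) - ℓ) = algMoment x ℓ * ((K : ℝ) * sampleMean x - ℓ) := by
  have h : (ℓ : ℝ) < K := by exact_mod_cast hℓ
  rw [algMoment_succ x (by omega), mul_assoc, div_mul_cancel₀ _ (by linarith)]

/-- `m_ℓ` vanishes when the vector has fewer than `ℓ` ones; otherwise the next factor of the
recursion lies in `[0, 1]`. -/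
lemma algMoment_mem_Icc_and_eq_zero {s : ℕ} (hs : s ≤ K) (hsx : (K : ℝ) * sampleMean x = s)
    (hK : K ≠ 0) {ℓ : ℕ} (hℓ : ℓ ≤ K) :
    0 ≤ algMoment x ℓ ∧ algMoment x ℓ ≤ 1 ∧ (s < ℓ → algMoment x ℓ = 0) ∧
      (ℓ + 1 ≤ K → 0 ≤ algMoment x (ℓ + 1) ∧ algMoment x (ℓ + 1) ≤ algMoment x ℓ) := by
  induction ℓ with
  | zero =>
    have hK' : (0 : ℝ) < K := by exact_mod_cast Nat.pos_of_ne_zero hK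
    have hs' : (s : ℝ) ≤ K := by exact_mod_cast hs
    refine ⟨by simp [algMoment], by simp [algMoment], by simp, fun _ => ?_⟩
    rw [algMoment_succ x hK, hsx]
    simp only [algMoment, Nat.cast_zero, sub_zero, one_mul]
    exact ⟨by positivity, div_le_one_of_le₀ hs' hK'.le⟩
  | succ ℓ ih =>
    obtain ⟨h0, h1, hz, hstep⟩ := ih (by omega)
    obtain ⟨hn0, hn1⟩ := hstep hℓ
    have hzero : s < ℓ + 1 → algMoment x (ℓ + 1) = 0 := by
      intro hlt
      rw [algMoment_succ x hK, hsx]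
      rcases Nat.lt_succ_iff_lt_or_eq.1 hlt with h | h
      · rw [hz h, zero_mul]
      · rw [h]
        simp
    refine ⟨hn0, hn1.trans h1, hzero, fun hK2 => ?_⟩
    rw [algMoment_succ x hK (ℓ + 1), hsx]
    have hden : (0 : ℝ) < (K : ℝ) - ((ℓ + 1 : ℕ) : ℝ) := by
      have : ((ℓ + 1 : ℕ) : ℝ) < K := by exact_mod_cast hK2
      linarith
    rcases lt_or_ge s (ℓ + 1) with h | h
    · simp [hzero h]
    · have h' : ((ℓ + 1 : ℕ) : ℝ) ≤ s := by exact_mod_cast h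
      have hs' : (s : ℝ) ≤ K := by exact_mod_cast hs
      refine ⟨mul_nonneg hn0 (div_nonneg (by linarith) hden.le),
        mul_le_of_le_one_right hn0 ((div_le_one hden).2 (by linarith))⟩

lemma algMoment_nonneg (hK : K ≠ 0) {ℓ : ℕ} (hℓ : ℓ ≤ K) : 0 ≤ algMoment x ℓ := by
  obtain ⟨s, hs, hsx⟩ := exists_natCast_eq_mul_sampleMean x hK
  exact (algMoment_mem_Icc_and_eq_zero x hs hsx hK hℓ).1

lemma algMoment_le_one (hK : K ≠ 0) {ℓ : ℕ} (hℓ : ℓ ≤ K) : algMoment x ℓ ≤ 1 := by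
  obtain ⟨s, hs, hsx⟩ := exists_natCast_eq_mul_sampleMean x hK
  exact (algMoment_mem_Icc_and_eq_zero x hs hsx hK hℓ).2.1

lemma algMoment_succ_le {ℓ : ℕ} (hℓ : ℓ + 1 ≤ K) : algMoment x (ℓ + 1) ≤ algMoment x ℓ := by
  have hK : K ≠ 0 := by omega
  obtain ⟨s, hs, hsx⟩ := exists_natCast_eq_mul_sampleMean x hK
  exact ((algMoment_mem_Icc_and_eq_zero x hs hsx hK (by omega)).2.2.2 hℓ).2

lemma sampleMean_sq (hK : 2 ≤ K) :
    sampleMean x ^ 2 = 1 / K * sampleMean x + ((K : ℝ) - 1) / K * algMoment x 2 := by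
  have h2 : (2 : ℝ) ≤ K := by exact_mod_cast hK
  rw [algMoment_succ x (by omega) 1, algMoment_one]
  push_cast
  have h0 : (K : ℝ) ≠ 0 := by linarith
  have h1 : (K : ℝ) - 1 ≠ 0 := by linarith
  field_simp
  ring

/-- The square of the mean of the products over pairs, expanded according to the number `4`, `3`
or `2` of distinct coordinates in two pairs. -/
lemma algMoment_two_sq (hK : 4 ≤ K) :
    algMoment x 2 ^ 2 = 2 / (K * ((K : ℝ) - 1)) * algMoment x 2 +
      4 * ((K : ℝ) - 2) / (K * ((K : ℝ) - 1)) * algMoment x 3 +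
      ((K : ℝ) - 2) * ((K : ℝ) - 3) / (K * ((K : ℝ) - 1)) * algMoment x 4 := by
  have h4 : (4 : ℝ) ≤ K := by exact_mod_cast hK
  have h0 : (K : ℝ) ≠ 0 := by linarith
  have h1 : (K : ℝ) - 1 ≠ 0 := by linarith
  have e2 : algMoment x 2 * (K - 1) = sampleMean x * (K * sampleMean x - 1) := by
    simpa using! algMoment_succ_mul x (ℓ := 1) (by omega)
  have e3 : algMoment x 3 * (K - 2) = algMoment x 2 * (K * sampleMean x - 2) := by
    simpa using! algMoment_succ_mul x (ℓ := 2) (by omega)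
  have e4 : algMoment x 4 * (K - 3) = algMoment x 3 * (K * sampleMean x - 3) := by
    simpa using! algMoment_succ_mul x (ℓ := 3) (by omega)
  generalize algMoment x 2 = a at *
  generalize algMoment x 3 = b at *
  generalize algMoment x 4 = c at *
  generalize sampleMean x = y at *
  field_simp
  linear_combination a * K * e2 - (4 + (K * y - 3)) * e3 - (K - 2) * e4

lemma algMoment_three_eq_four (hK : 4 ≤ K) (h : algMoment x 2 = algMoment x 3) :
    algMoment x 3 = algMoment x 4 := by
  have h4 : (4 : ℝ) ≤ K := by exact_mod_cast hK
  have h3 : (K : ℝ) - 3 ≠ 0 := by linarith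
  have e3 : algMoment x 3 * (K - 2) = algMoment x 2 * (K * sampleMean x - 2) := by
    simpa using! algMoment_succ_mul x (ℓ := 2) (by omega)
  have e4 : algMoment x 4 * (K - 3) = algMoment x 3 * (K * sampleMean x - 3) := by
    simpa using! algMoment_succ_mul x (ℓ := 3) (by omega)
  have : (algMoment x 3 - algMoment x 4) * (K - 3) = 0 := by
    rw [h] at e3
    linear_combination e3 - e4
  exact sub_eq_zero.1 ((mul_eq_zero.1 this).resolve_right h3)

end Moments

/-! ### Empirical moments -/

section Empirical

variable {K n : ℕ} (x : Fin n → Fin K → Fin 2)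

/-- The Cauchy–Schwarz inequality for an average. -/
lemma sq_average_le {n : ℕ} (f : Fin n → ℝ) :
    ((1 / (n : ℝ)) * ∑ i, f i) ^ 2 ≤ (1 / (n : ℝ)) * ∑ i, f i ^ 2 := by
  rcases Nat.eq_zero_or_pos n with rfl | hn
  · simp
  have hn' : (0 : ℝ) < n := by exact_mod_cast hn
  have h := sq_sum_le_card_mul_sum_sq (s := Finset.univ) (f := f)
  rw [Finset.card_univ, Fintype.card_fin] at h
  rw [mul_pow, one_div, inv_pow, inv_mul_le_iff₀ (by positivity)]
  calc (∑ i, f i) ^ 2 ≤ n * ∑ i, f i ^ 2 := h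
    _ = _ := by field_simp

lemma empMoment_nonneg (hK : K ≠ 0) {ℓ : ℕ} (hℓ : ℓ ≤ K) : 0 ≤ empMoment x ℓ :=
  mul_nonneg (by positivity) (Finset.sum_nonneg fun i _ => algMoment_nonneg (x i) hK hℓ)

lemma empMoment_le_one (hK : K ≠ 0) {ℓ : ℕ} (hℓ : ℓ ≤ K) : empMoment x ℓ ≤ 1 := by
  have h : ∑ i, algMoment (x i) ℓ ≤ ∑ _i : Fin n, (1 : ℝ) :=
    Finset.sum_le_sum fun i _ => algMoment_le_one (x i) hK hℓ
  rw [empMoment, one_div_mul_eq_div]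
  exact div_le_one_of_le₀ (by simpa using h) (by positivity)

lemma empMoment_one_sq_le (hK : 2 ≤ K) :
    empMoment x 1 ^ 2 ≤ 1 / K * empMoment x 1 + ((K : ℝ) - 1) / K * empMoment x 2 := by
  refine (sq_average_le _).trans_eq ?_
  simp only [algMoment_one, empMoment, sampleMean_sq _ hK, Finset.sum_add_distrib,
    ← Finset.mul_sum]
  ring

lemma empMoment_two_sq_le (hK : 4 ≤ K) :
    empMoment x 2 ^ 2 ≤ 2 / (K * ((K : ℝ) - 1)) * empMoment x 2 +
      4 * ((K : ℝ) - 2) / (K * ((K : ℝ) - 1)) * empMoment x 3 +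
      ((K : ℝ) - 2) * ((K : ℝ) - 3) / (K * ((K : ℝ) - 1)) * empMoment x 4 := by
  refine (sq_average_le _).trans_eq ?_
  simp only [empMoment, algMoment_two_sq _ hK, Finset.sum_add_distrib, ← Finset.mul_sum]
  ring

end Empirical

/-! ### Laws of large numbers -/

section Sampling

variable {Ω : Type*} [MeasurableSpace Ω] {P : Measure Ω} [IsProbabilityMeasure P] {K : ℕ}
  {X : ℕ → Ω → Fin K → Fin 2}

lemma measurable_of_cube {n : ℕ} {E : Type*} [MeasurableSpace E]
    (f : (Fin n → Fin K → Fin 2) → E) : Measurable f := .of_discrete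

lemma memLp_comp {Y : Ω → Fin K → Fin 2} (hY : AEMeasurable Y P) (f : (Fin K → Fin 2) → ℝ)
    (p : ENNReal) : MemLp (fun ω => f (Y ω)) p P := by
  obtain ⟨C, hC⟩ := (Set.finite_range f).isBounded.exists_norm_le
  exact MemLp.of_bound ((Measurable.of_discrete (f := f)).comp_aemeasurable hY).aestronglyMeasurable
    C (ae_of_all _ fun ω => hC _ ⟨_, rfl⟩)

lemma integrable_comp {Y : Ω → Fin K → Fin 2} (hY : AEMeasurable Y P) (f : (Fin K → Fin 2) → ℝ) :
    Integrable (fun ω => f (Y ω)) P :=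
  memLp_one_iff_integrable.1 (memLp_comp hY f 1)

lemma ae_tendsto_empMoment (hident : ∀ i, IdentDistrib (X i) (X 0) P P) (hindep : iIndepFun X P)
    (ℓ : ℕ) :
    ∀ᵐ ω ∂P, Tendsto (fun n => empMoment (fun i : Fin n => X i ω) ℓ) atTop
      (𝓝 (∫ ω, algMoment (X 0 ω) ℓ ∂P)) := by
  have hm : Measurable fun y : Fin K → Fin 2 => algMoment y ℓ := .of_discrete
  have h := strong_law_ae_real (μ := P) (fun i ω => algMoment (X i ω) ℓ)
    (integrable_comp (hident 0).aemeasurable_fst fun y => algMoment y ℓ)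
    (fun i j hij => (hindep.indepFun hij).comp hm hm) (fun i => (hident i).comp hm)
  filter_upwards [h] with ω hω
  refine hω.congr fun n => ?_
  rw [empMoment, one_div_mul_eq_div, Finset.sum_range]

lemma variance_sampleMean_eq {Y : Ω → Fin K → Fin 2} (hY : AEMeasurable Y P) :
    Var[fun ω => sampleMean (Y ω); P] =
      ∫ ω, sampleMean (Y ω) ^ 2 ∂P - (∫ ω, sampleMean (Y ω) ∂P) ^ 2 :=
  variance_eq_sub (memLp_comp hY sampleMean 2)

/-- If `m₂` and `m₃` have the same mean, then, as `m₃ ≤ m₂`, they agree almost surely on every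
sample. -/
lemma ae_algMoment_two_eq_three (hident : ∀ i, IdentDistrib (X i) (X 0) P P) (hK : 3 ≤ K)
    (h : ∫ ω, algMoment (X 0 ω) 2 ∂P = ∫ ω, algMoment (X 0 ω) 3 ∂P) :
    ∀ᵐ ω ∂P, ∀ i, algMoment (X i ω) 2 = algMoment (X i ω) 3 := by
  refine ae_all_iff.2 fun i => (hident i).symm.ae_snd
    (p := fun y : Fin K → Fin 2 => algMoment y 2 = algMoment y 3) (Set.toFinite _).measurableSet ?_
  have hX := (hident 0).aemeasurable_fst
  have h2 := integrable_comp (P := P) hX fun y => algMoment y 2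
  have h3 := integrable_comp (P := P) hX fun y => algMoment y 3
  have h0 : ∫ ω, (algMoment (X 0 ω) 2 - algMoment (X 0 ω) 3) ∂P = 0 := by
    rw [integral_sub h2 h3, h, sub_self]
  have := (integral_eq_zero_iff_of_nonneg
    (fun ω => sub_nonneg.2 (algMoment_succ_le (X 0 ω) hK)) (h2.sub h3)).1 h0
  filter_upwards [this] with ω hω using sub_eq_zero.1 hω

end Sampling

/-! ### Asymptotic coverage of score intervals -/

section Coverage

variable {Ω : Type*} [MeasurableSpace Ω] {P : Measure Ω} [IsProbabilityMeasure P] {K : ℕ}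
  {X : ℕ → Ω → Fin K → Fin 2}

lemma LimAtLeast.mono {u : ℕ → ℝ} {p q : ℝ} (h : LimAtLeast u p) (hq : q ≤ p) :
    LimAtLeast u q :=
  let ⟨l, hl, hpl⟩ := h
  ⟨l, hl, hq.trans hpl⟩

lemma sqrt_mul_empMoment_one_sub (n : ℕ) (y : ℕ → Fin K → Fin 2) (μ : ℝ) :
    √n * (empMoment (fun i : Fin n => y i) 1 - μ) =
      (√n)⁻¹ * (∑ k ∈ Finset.range n, sampleMean (y k) - n * μ) := by
  rcases Nat.eq_zero_or_pos n with rfl | hn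
  · simp
  have hn' : (0 : ℝ) < n := by exact_mod_cast hn
  have hs : 0 < √(n : ℝ) := Real.sqrt_pos.2 hn'
  have hsq : √(n : ℝ) * √(n : ℝ) = n := Real.mul_self_sqrt hn'.le
  rw [empMoment, Finset.sum_range]
  simp only [algMoment_one]
  generalize ∑ i : Fin n, sampleMean (y i) = S
  rw [eq_inv_mul_iff_mul_eq₀ hs.ne', ← mul_assoc, hsq]
  field_simp

lemma ae_sampleMean_eq_of_variance_eq_zero (hX : ∀ i, AEMeasurable (X i) P)
    (hident : ∀ i, IdentDistrib (X i) (X 0) P P) {μ : ℝ}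
    (hμ : ∫ ω, sampleMean (X 0 ω) ∂P = μ) (hv : Var[fun ω => sampleMean (X 0 ω); P] = 0) :
    ∀ᵐ ω ∂P, ∀ i, sampleMean (X i ω) = μ := by
  refine ae_all_iff.2 fun i => ((hident i).comp
    (Measurable.of_discrete (f := sampleMean (K := K)))).symm.ae_snd (p := fun y => y = μ)
    (measurableSet_singleton μ) ?_
  simpa [hμ] using ae_eq_integral_of_variance_eq_zero
    (memLp_comp (hX 0) (sampleMean (K := K)) 2) hv

/-- The scaled deviation `√n (μ̂₁ - μ)` meets `g · ≤ √(T n)` with a limiting probability that is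
at least the standard Gaussian probability of `g · ≤ |Z|`, if the limit `T₀` of `T n` is at least
`Z²` times the variance. If the variance vanishes, the deviation is almost surely zero and the
limit is `1`. -/
lemma limAtLeast_of_eventually_iff (hX : ∀ i, AEMeasurable (X i) P)
    (hident : ∀ i, IdentDistrib (X i) (X 0) P P) (hindep : iIndepFun X P) {μ : ℝ}
    (hμ : ∫ ω, sampleMean (X 0 ω) ∂P = μ)
    {A : ∀ n, (Fin n → Fin K → Fin 2) → Prop} {T : ∀ n, (Fin n → Fin K → Fin 2) → ℝ}
    {T₀ Z q : ℝ} {g : ℝ → ℝ}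
    (hT : ∀ᵐ ω ∂P, Tendsto (fun n => T n fun i : Fin n => X i ω) atTop (𝓝 T₀))
    (hT₀ : Z ^ 2 * Var[fun ω => sampleMean (X 0 ω); P] ≤ T₀)
    (hg : Continuous g) (hgabs : ∀ x, |g x| = |x|) (hghom : ∀ s x, 0 ≤ s → g (s * x) = s * g x)
    (hA : ∀ᵐ ω ∂P, ∀ᶠ n : ℕ in atTop, (A n (fun i : Fin n => X i ω) ↔
      g (√n * (empMoment (fun i : Fin n => X i ω) 1 - μ)) ≤ √(T n fun i : Fin n => X i ω)))
    (hq : q ≤ (gaussianReal 0 1).real {x | g x ≤ |Z|}) :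
    LimAtLeast (fun n => P.real {ω | A n fun i : Fin n => X i ω}) q := by
  have hmeasA : ∀ n, NullMeasurableSet {ω | A n fun i : Fin n => X i ω} P := fun n =>
    (aemeasurable_pi_lambda _ fun i : Fin n => hX i).nullMeasurableSet_preimage
      (s := {y | A n y}) (Set.toFinite _).measurableSet
  have hmean : Measurable fun y : Fin K → Fin 2 => sampleMean y := .of_discrete
  have hTm : ∀ n, AEMeasurable (fun ω => T n fun i : Fin n => X i ω) P := fun n =>
    (measurable_of_cube (T n)).comp_aemeasurable (aemeasurable_pi_lambda _ fun i : Fin n => hX i)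
  have hYm : ∀ i, AEMeasurable (fun ω => sampleMean (X i ω)) P := fun i =>
    hmean.comp_aemeasurable (hX i)
  have hmem := memLp_comp (hX 0) (sampleMean (K := K)) 2
  have hYident : ∀ i, IdentDistrib (fun ω => sampleMean (X i ω)) (fun ω => sampleMean (X 0 ω)) P P :=
    fun i => (hident i).comp hmean
  rcases (variance_nonneg (fun ω => sampleMean (X 0 ω)) P).eq_or_lt' with hv | hv
  · refine ⟨1, ?_, hq.trans measureReal_le_one⟩
    have hconst := ae_sampleMean_eq_of_variance_eq_zero hX hident hμ hv
    refine tendsto_measureReal_congr (B := fun _ => Set.univ) hmeasA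
      (fun _ => MeasurableSet.univ.nullMeasurableSet) ?_ (by simp)
    filter_upwards [hA, hconst] with ω hω hc
    filter_upwards [hω] with n hn
    have hg0 : g 0 = 0 := by simpa using hgabs 0
    have hzero : √n * (empMoment (fun i : Fin n => X i ω) 1 - μ) = 0 := by
      rw [sqrt_mul_empMoment_one_sub n (fun i => X i ω)]
      simp [hc]
    rw [hzero, hg0] at hn
    simpa using hn.2 (Real.sqrt_nonneg _)
  · have hclt := tendsto_measureReal_clt (Y := fun i ω => sampleMean (X i ω)) hmem
      (hindep.comp (fun _ => sampleMean) fun _ => hmean) hYident hv hTm hT hg hgabs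
    refine ⟨_, tendsto_measureReal_congr hmeasA (fun n => ?_) ?_ hclt, hq.trans ?_⟩
    · refine nullMeasurableSet_le (hg.measurable.comp_aemeasurable ?_) (hTm n).sqrt
      exact ((Finset.aemeasurable_fun_sum _ fun i _ => hYm i).sub_const _).const_mul _
    · filter_upwards [hA] with ω hω
      filter_upwards [hω] with n hn
      rw [sqrt_mul_empMoment_one_sub n (fun i => X i ω)] at hn
      rw [hμ]
      exact hn
    · refine measureReal_mono fun x hx => ?_
      calc g (√Var[fun ω => sampleMean (X 0 ω); P] * x)
          = √Var[fun ω => sampleMean (X 0 ω); P] * g x := hghom _ _ (Real.sqrt_nonneg _)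
        _ ≤ √Var[fun ω => sampleMean (X 0 ω); P] * |Z| :=
          mul_le_mul_of_nonneg_left hx (Real.sqrt_nonneg _)
        _ = √(Z ^ 2 * Var[fun ω => sampleMean (X 0 ω); P]) := by
          rw [Real.sqrt_mul (sq_nonneg Z), Real.sqrt_sq_eq_abs, mul_comm]
        _ ≤ √T₀ := Real.sqrt_le_sqrt hT₀

/-- Asymptotic validity of an algorithm whose output is eventually the pair of roots of the score
quadratic `n (x - μ̂₁)² = Z² (B x + c - x²)`, where the term `c` of the variance estimate depends on
the samples. The estimate has to be consistent for an upper bound on the true variance, and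
nonnegative at `μ̂₁`. -/
lemma asymptoticallyValid_of_eventually_roots (hX : ∀ i, AEMeasurable (X i) P)
    (hident : ∀ i, IdentDistrib (X i) (X 0) P P) (hindep : iIndepFun X P) {μ : ℝ}
    (hμ : ∫ ω, sampleMean (X 0 ω) ∂P = μ)
    {Out : ∀ n : ℕ, (Fin n → Fin K → Fin 2) → ℝ → ℝ → Prop}
    {Z B C₀ γ β C : ℝ} (c : ∀ n, (Fin n → Fin K → Fin 2) → ℝ)
    (hγ : 1 - γ ≤ (gaussianReal 0 1).real (Set.Iic |Z|)) (hγβ : γ ≤ β) (hγC : 2 * γ ≤ C * β)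
    (hc : ∀ᵐ ω ∂P, Tendsto (fun n => c n fun i : Fin n => X i ω) atTop (𝓝 C₀))
    (hvar : Var[fun ω => sampleMean (X 0 ω); P] ≤ B * μ + C₀ - μ ^ 2)
    (hnonneg : ∀ᵐ ω ∂P, ∀ᶠ n : ℕ in atTop,
      0 ≤ B * empMoment (fun i : Fin n => X i ω) 1 + c n (fun i : Fin n => X i ω) -
        empMoment (fun i : Fin n => X i ω) 1 ^ 2)
    (hOut : ∀ᵐ ω ∂P, ∀ᶠ n : ℕ in atTop, ∀ L U, Out n (fun i : Fin n => X i ω) L U ↔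
      IsSmallerRoot (n + Z ^ 2) (2 * n * empMoment (fun i : Fin n => X i ω) 1 + Z ^ 2 * B)
        (n * empMoment (fun i : Fin n => X i ω) 1 ^ 2 - Z ^ 2 * c n fun i : Fin n => X i ω) L ∧
      IsLargerRoot (n + Z ^ 2) (2 * n * empMoment (fun i : Fin n => X i ω) 1 + Z ^ 2 * B)
        (n * empMoment (fun i : Fin n => X i ω) 1 ^ 2 - Z ^ 2 * c n fun i : Fin n => X i ω) U) :
    AsymptoticallyValid P X Out μ β C := by
  set v := Var[fun ω => sampleMean (X 0 ω); P]
  set T : ∀ n, (Fin n → Fin K → Fin 2) → ℝ := fun n y => Z ^ 2 * (B * μ + c n y - μ ^ 2)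
  have hT : ∀ᵐ ω ∂P, Tendsto (fun n => T n fun i : Fin n => X i ω) atTop
      (𝓝 (Z ^ 2 * (B * μ + C₀ - μ ^ 2))) := by
    filter_upwards [hc] with ω hω
    exact ((hω.const_add _).sub_const _).const_mul _
  have hT₀ : Z ^ 2 * v ≤ Z ^ 2 * (B * μ + C₀ - μ ^ 2) :=
    mul_le_mul_of_nonneg_left hvar (sq_nonneg Z)
  have hTnonneg : ∀ᵐ ω ∂P, ∀ᶠ n : ℕ in atTop, 0 ≤ T n fun i : Fin n => X i ω := by
    rcases (variance_nonneg (fun ω => sampleMean (X 0 ω)) P).eq_or_lt' with h0 | h0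
    · -- here the empirical mean is almost surely equal to `μ`
      have hconst := ae_sampleMean_eq_of_variance_eq_zero hX hident hμ h0
      filter_upwards [hconst, hnonneg] with ω hω hn
      filter_upwards [hn, eventually_gt_atTop 0] with n hn hpos
      have hpos' : (n : ℝ) ≠ 0 := by exact_mod_cast hpos.ne'
      have hM : empMoment (fun i : Fin n => X i ω) 1 = μ := by
        simp [empMoment, algMoment_one, hω, hpos']
      rw [hM] at hn
      exact mul_nonneg (sq_nonneg Z) hn
    · filter_upwards [hc] with ω hω
      have hlim : Tendsto (fun n => B * μ + c n (fun i : Fin n => X i ω) - μ ^ 2) atTop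
          (𝓝 (B * μ + C₀ - μ ^ 2)) := (hω.const_add _).sub_const _
      filter_upwards [hlim.eventually_const_lt (h0.trans_le hvar)] with n hn
      exact mul_nonneg (sq_nonneg Z) hn.le
  have hroots : ∀ᵐ ω ∂P, ∀ᶠ n : ℕ in atTop, ∃ L U,
      (∀ L' U', Out n (fun i : Fin n => X i ω) L' U' ↔ L' = L ∧ U' = U) ∧
      (L ≤ μ ↔ √n * (empMoment (fun i : Fin n => X i ω) 1 - μ) ≤
        √(T n fun i : Fin n => X i ω)) ∧
      (μ ≤ U ↔ -(√n * (empMoment (fun i : Fin n => X i ω) 1 - μ)) ≤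
        √(T n fun i : Fin n => X i ω)) := by
    filter_upwards [hTnonneg, hnonneg, hOut] with ω h1 h2 h3
    filter_upwards [h1, h2, h3, eventually_gt_atTop 0] with n h1 h2 h3 hpos
    obtain ⟨L, U, hLU, hL, hU⟩ :=
      roots_le_iff (n := n) (by exact_mod_cast hpos) (sq_nonneg Z) h2 h1
    exact ⟨L, U, fun L' U' => (h3 L' U').trans (hLU L' U'), hL, hU⟩
  refine ⟨LimAtLeast.mono (p := 1 - γ) ?_ (by linarith),
    LimAtLeast.mono (p := 1 - γ) ?_ (by linarith),
    LimAtLeast.mono (p := 1 - 2 * γ) ?_ (by linarith)⟩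
  · refine limAtLeast_of_eventually_iff hX hident hindep hμ
      (A := fun n y => ∃ L U, Out n y L U ∧ L ≤ μ) hT hT₀ continuous_id (fun _ => rfl)
      (fun _ _ _ => rfl) ?_ hγ
    filter_upwards [hroots] with ω hω
    filter_upwards [hω] with n hn
    obtain ⟨L, U, hLU, hL, -⟩ := hn
    simp [hLU, ← hL]
  · refine limAtLeast_of_eventually_iff hX hident hindep hμ
      (A := fun n y => ∃ L U, Out n y L U ∧ μ ≤ U) hT hT₀ continuous_neg abs_neg
      (fun s x _ => (mul_neg s x).symm) ?_ (hγ.trans_eq (gaussianReal_real_neg_le _).symm)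
    filter_upwards [hroots] with ω hω
    filter_upwards [hω] with n hn
    obtain ⟨L, U, hLU, -, hU⟩ := hn
    simp [hLU, ← hU]
  · refine limAtLeast_of_eventually_iff hX hident hindep hμ
      (A := fun n y => ∃ L U, Out n y L U ∧ L ≤ μ ∧ μ ≤ U) hT hT₀ continuous_abs abs_abs
      (fun s x hs => by rw [abs_mul, abs_of_nonneg hs]) ?_ (le_gaussianReal_real_abs_le hγ)
    filter_upwards [hroots] with ω hω
    filter_upwards [hω] with n hn
    obtain ⟨L, U, hLU, hL, hU⟩ := hn
    rw [abs_le', ← hL, ← hU]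
    simp [hLU]

end Coverage

/-! ### The three intervals -/

section Intervals

variable {Ω : Type*} [MeasurableSpace Ω] {P : Measure Ω} [IsProbabilityMeasure P] {K : ℕ}
  {X : ℕ → Ω → Fin K → Fin 2} {β : ℝ}

lemma asymptoticallyValid_firstOrder (hX : ∀ i, AEMeasurable (X i) P)
    (hident : ∀ i, IdentDistrib (X i) (X 0) P P) (hindep : iIndepFun X P)
    (hβ0 : 0 < β) (hβ1 : β < 1) (hK : K ≠ 0) :
    AsymptoticallyValid P X (fun _ x L U => FirstOrderOutput β x L U)
      (∫ ω, sampleMean (X 0 ω) ∂P) β 2 := by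
  have hle : ∀ {n : ℕ} (y : Fin n → Fin K → Fin 2), empMoment y 1 ^ 2 ≤ empMoment y 1 := fun y => by
    have h0 := empMoment_nonneg y hK (Nat.one_le_iff_ne_zero.2 hK)
    have h1 := empMoment_le_one y hK (Nat.one_le_iff_ne_zero.2 hK)
    nlinarith
  refine asymptoticallyValid_of_eventually_roots hX hident hindep rfl (Z := gaussQuantile β)
    (B := 1) (C₀ := 0) (γ := β) (fun _ _ => 0) (le_gaussianReal_Iic_abs hβ0 hβ1) le_rfl le_rfl
    (ae_of_all _ fun _ => tendsto_const_nhds) ?_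
    (ae_of_all _ fun ω => Eventually.of_forall fun n => ?_)
    (ae_of_all _ fun ω => Eventually.of_forall fun n L U => ?_)
  · rw [variance_sampleMean_eq (hX 0)]
    have : ∫ ω, sampleMean (X 0 ω) ^ 2 ∂P ≤ ∫ ω, sampleMean (X 0 ω) ∂P := by
      refine integral_mono (integrable_comp (hX 0) fun y => sampleMean y ^ 2)
        (integrable_comp (hX 0) sampleMean) fun ω => ?_
      have h0 := algMoment_nonneg (X 0 ω) hK (Nat.one_le_iff_ne_zero.2 hK)
      have h1 := algMoment_le_one (X 0 ω) hK (Nat.one_le_iff_ne_zero.2 hK)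
      rw [algMoment_one] at h0 h1
      simp only
      nlinarith
    linarith
  · linarith [hle fun i : Fin n => X i ω]
  · simp only [FirstOrderOutput, mul_one, mul_zero, sub_zero]

/-- The last step is asymptotically valid if the plug-in for `E[m₂]` is consistent and eventually
not below the empirical moment `μ̂₂`. -/
lemma asymptoticallyValid_of_finalStep (hX : ∀ i, AEMeasurable (X i) P)
    (hident : ∀ i, IdentDistrib (X i) (X 0) P P) (hindep : iIndepFun X P) (hK : 2 ≤ K)
    {Out : ∀ n : ℕ, (Fin n → Fin K → Fin 2) → ℝ → ℝ → Prop} {γ C : ℝ}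
    (u : ∀ n, (Fin n → Fin K → Fin 2) → ℝ) (hγ0 : 0 < γ) (hγ1 : γ < 1) (hγβ : γ ≤ β)
    (hγC : 2 * γ ≤ C * β)
    (hu : ∀ᵐ ω ∂P, Tendsto (fun n => u n fun i : Fin n => X i ω) atTop
      (𝓝 (∫ ω, algMoment (X 0 ω) 2 ∂P)))
    (hle : ∀ᵐ ω ∂P, ∀ᶠ n : ℕ in atTop,
      empMoment (fun i : Fin n => X i ω) 2 ≤ u n fun i : Fin n => X i ω)
    (hOut : ∀ᵐ ω ∂P, ∀ᶠ n : ℕ in atTop, ∀ L U, Out n (fun i : Fin n => X i ω) L U ↔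
      FinalStep (gaussQuantile γ) (fun i : Fin n => X i ω) (u n fun i : Fin n => X i ω) L U) :
    AsymptoticallyValid P X Out (∫ ω, sampleMean (X 0 ω) ∂P) β C := by
  have hK' : (2 : ℝ) ≤ K := by exact_mod_cast hK
  refine asymptoticallyValid_of_eventually_roots hX hident hindep rfl (Z := gaussQuantile γ)
    (B := 1 / K) (C₀ := ((K : ℝ) - 1) / K * ∫ ω, algMoment (X 0 ω) 2 ∂P) (γ := γ)
    (fun n y => ((K : ℝ) - 1) / K * u n y) (le_gaussianReal_Iic_abs hγ0 hγ1) hγβ hγC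
    ?_ ?_ ?_ ?_
  · filter_upwards [hu] with ω hω using hω.const_mul _
  · rw [variance_sampleMean_eq (hX 0)]
    simp only [sampleMean_sq _ hK]
    rw [integral_add ((integrable_comp (hX 0) sampleMean).const_mul _)
      ((integrable_comp (hX 0) fun y => algMoment y 2).const_mul _), integral_const_mul,
      integral_const_mul]
  · filter_upwards [hle] with ω hω
    filter_upwards [hω] with n hn
    have h1 := empMoment_one_sq_le (fun i : Fin n => X i ω) hK
    have h2 : (0 : ℝ) ≤ ((K : ℝ) - 1) / K := div_nonneg (by linarith) (by linarith)
    linarith [mul_le_mul_of_nonneg_left hn h2]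
  · filter_upwards [hOut] with ω hω
    filter_upwards [hω] with n hn L U
    rw [hn]
    simp only [FinalStep]
    rw [mul_one_div, ← mul_assoc, mul_comm (gaussQuantile γ ^ 2) (((K : ℝ) - 1) / K)]

lemma asymptoticallyValid_secondOrder (hX : ∀ i, AEMeasurable (X i) P)
    (hident : ∀ i, IdentDistrib (X i) (X 0) P P) (hindep : iIndepFun X P)
    (hβ0 : 0 < β) (hβ1 : β < 1) (hK : 2 ≤ K) :
    AsymptoticallyValid P X (fun _ x L U => SecondOrderOutput β x L U)
      (∫ ω, sampleMean (X 0 ω) ∂P) β (3 / 2) := by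
  set z := gaussQuantile (β / 2) ^ 2
  have hwilson : ∀ {n : ℕ} (y : Fin n → Fin K → Fin 2), 0 < n → _ := fun {n} y hn =>
    largerRoot_wilson (n := n) (z := z) (p := empMoment y 2) (by exact_mod_cast hn)
      (sq_nonneg _) (empMoment_nonneg y (by omega) hK) (empMoment_le_one y (by omega) hK)
  refine asymptoticallyValid_of_finalStep hX hident hindep hK (γ := β / 2)
    (fun n y => largerRoot (n + z) (2 * n * empMoment y 2 + z) (n * empMoment y 2 ^ 2))
    (by linarith) (by linarith) (by linarith) (by linarith) ?_
    (ae_of_all _ fun ω => ?_) (ae_of_all _ fun ω => ?_)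
  · filter_upwards [ae_tendsto_empMoment hident hindep 2] with ω hω
    simpa using tendsto_largerRoot z z hω (tendsto_const_nhds (x := 0))
  · filter_upwards [eventually_gt_atTop 0] with n hn using (hwilson _ hn).2.1
  · filter_upwards [eventually_gt_atTop 0] with n hn L U
    simp only [SecondOrderOutput]
    simp only [(hwilson (fun i : Fin n => X i ω) hn).1, exists_eq_left, z]

/-- The variance estimate for `m₂` in the fourth-order algorithm,
`2x / (k(k-1)) + c - 2(2k-3) x² / (k(k-1))`, is nonnegative at `x = μ̂₂`: it is at least the empirical
variance if `ū₃ ≤ μ̂₂`, and it is a sum of nonnegative terms if `μ̂₂ = μ̂₃` and `ū₃ = ū₄ ≤ 1`. -/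
lemma fourthOrder_variance_nonneg {k p p₃ p₄ u₃ u₄ : ℝ} (hk : 4 ≤ k) (hp0 : 0 ≤ p) (hp1 : p ≤ 1)
    (hsq : p ^ 2 ≤ 2 / (k * (k - 1)) * p + 4 * (k - 2) / (k * (k - 1)) * p₃ +
      (k - 2) * (k - 3) / (k * (k - 1)) * p₄)
    (hp₃ : 0 ≤ p₃) (hu₃ : p₃ ≤ u₃) (hu₄ : p₄ ≤ u₄)
    (h : u₃ ≤ p ∨ (p = p₃ ∧ u₃ = u₄ ∧ u₃ ≤ 1)) :
    0 ≤ 2 / (k * (k - 1)) * p + ((k - 2) * (k - 3) / (k * (k - 1)) * (u₄ - u₃ ^ 2) +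
      4 * (k - 2) / (k * (k - 1)) * u₃) - 2 * (2 * k - 3) / (k * (k - 1)) * p ^ 2 := by
  have hden : 0 < k * (k - 1) := mul_pos (by linarith) (by linarith)
  have hα : 0 ≤ (k - 2) * (k - 3) / (k * (k - 1)) :=
    div_nonneg (mul_nonneg (by linarith) (by linarith)) hden.le
  have hγ : 0 ≤ 4 * (k - 2) / (k * (k - 1)) := div_nonneg (by linarith) hden.le
  have hδ : 0 ≤ 2 / (k * (k - 1)) := by positivity
  have hsum : 2 / (k * (k - 1)) + 4 * (k - 2) / (k * (k - 1)) =
      2 * (2 * k - 3) / (k * (k - 1)) := by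
    rw [← add_div]
    ring
  have hone : 2 * (2 * k - 3) / (k * (k - 1)) + (k - 2) * (k - 3) / (k * (k - 1)) = 1 := by
    rw [← add_div, div_eq_one_iff_eq hden.ne']
    ring
  generalize (k - 2) * (k - 3) / (k * (k - 1)) = α at *
  generalize 4 * (k - 2) / (k * (k - 1)) = η at *
  generalize 2 / (k * (k - 1)) = δ at *
  generalize 2 * (2 * k - 3) / (k * (k - 1)) = ε at *
  rcases h with h | ⟨rfl, rfl, h⟩
  · have h1 : u₃ ^ 2 ≤ p ^ 2 := pow_le_pow_left₀ (by linarith) h 2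
    have hε : ε = 1 - α := by linarith
    subst hε
    nlinarith [mul_nonneg hγ (sub_nonneg.2 hu₃), mul_nonneg hα (sub_nonneg.2 hu₄),
      mul_nonneg hα (sub_nonneg.2 h1)]
  · have hpp : p ^ 2 ≤ p := by nlinarith
    have huu : u₃ ^ 2 ≤ u₃ := by nlinarith
    subst hsum
    nlinarith [mul_nonneg hγ (sub_nonneg.2 hu₃), mul_nonneg hα (sub_nonneg.2 huu),
      mul_nonneg hγ (sub_nonneg.2 hpp), mul_nonneg hδ (sub_nonneg.2 hpp)]

lemma asymptoticallyValid_fourthOrder (hX : ∀ i, AEMeasurable (X i) P)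
    (hident : ∀ i, IdentDistrib (X i) (X 0) P P) (hindep : iIndepFun X P)
    (hβ0 : 0 < β) (hβ1 : β < 1) (hK : 4 ≤ K) :
    AsymptoticallyValid P X (fun _ x L U => FourthOrderOutput β x L U)
      (∫ ω, sampleMean (X 0 ω) ∂P) β (5 / 4) := by
  have hk : (4 : ℝ) ≤ K := by exact_mod_cast hK
  set z := gaussQuantile (β / 4) ^ 2 with hz
  have hz0 : 0 ≤ z := sq_nonneg _
  set k := (K : ℝ)
  have hden : 0 < k * (k - 1) := mul_pos (by linarith) (by linarith)
  set w : ∀ n, (Fin n → Fin K → Fin 2) → ℕ → ℝ := fun n y ℓ =>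
    largerRoot (n + z) (2 * n * empMoment y ℓ + z) (n * empMoment y ℓ ^ 2) with hw
  set d : ∀ n, (Fin n → Fin K → Fin 2) → ℝ := fun n y =>
    (k - 2) * (k - 3) / (k * (k - 1)) * (w n y 4 - w n y 3 ^ 2) +
      4 * (k - 2) / (k * (k - 1)) * w n y 3 with hd
  set u : ∀ n, (Fin n → Fin K → Fin 2) → ℝ := fun n y =>
    largerRoot (n + 2 * z * (2 * k - 3) / (k * (k - 1)))
      (2 * n * empMoment y 2 + 2 * z / (k * (k - 1)))
      (n * empMoment y 2 ^ 2 - d n y * z)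
  have hwilson : ∀ {n : ℕ} (y : Fin n → Fin K → Fin 2) {ℓ : ℕ}, ℓ ≤ K → 0 < n → _ :=
    fun {n} y {ℓ} hℓ hn => largerRoot_wilson (n := n) (z := z) (p := empMoment y ℓ)
      (by exact_mod_cast hn) hz0 (empMoment_nonneg y (by omega) hℓ)
      (empMoment_le_one y (by omega) hℓ)
  have hwlim : ∀ ℓ, ∀ᵐ ω ∂P, Tendsto (fun n => w n (fun i : Fin n => X i ω) ℓ) atTop
      (𝓝 (∫ ω, algMoment (X 0 ω) ℓ ∂P)) := fun ℓ => by
    filter_upwards [ae_tendsto_empMoment hident hindep ℓ] with ω hω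
    simpa using tendsto_largerRoot z z hω (tendsto_const_nhds (x := 0))
  have hulim : ∀ᵐ ω ∂P, Tendsto (fun n => u n fun i : Fin n => X i ω) atTop
      (𝓝 (∫ ω, algMoment (X 0 ω) 2 ∂P)) := by
    filter_upwards [ae_tendsto_empMoment hident hindep 2, hwlim 3, hwlim 4] with ω h2 h3 h4
    exact tendsto_largerRoot _ _ h2
      ((((h4.sub (h3.pow 2)).const_mul _).add (h3.const_mul _)).mul_const z)
  have hcase : ∀ᵐ ω ∂P, ∀ᶠ n : ℕ in atTop,
      w n (fun i : Fin n => X i ω) 3 ≤ empMoment (fun i : Fin n => X i ω) 2 ∨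
      (empMoment (fun i : Fin n => X i ω) 2 = empMoment (fun i : Fin n => X i ω) 3 ∧
        w n (fun i : Fin n => X i ω) 3 = w n (fun i : Fin n => X i ω) 4 ∧
        w n (fun i : Fin n => X i ω) 3 ≤ 1) := by
    have hmono : ∫ ω, algMoment (X 0 ω) 3 ∂P ≤ ∫ ω, algMoment (X 0 ω) 2 ∂P :=
      integral_mono (integrable_comp (hX 0) fun y => algMoment y 3)
        (integrable_comp (hX 0) fun y => algMoment y 2)
        fun ω => algMoment_succ_le (X 0 ω) (by omega)
    rcases hmono.lt_or_eq with hlt | heq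
    · filter_upwards [ae_tendsto_empMoment hident hindep 2, hwlim 3] with ω h2 h3
      filter_upwards [h3.eventually_lt h2 hlt] with n hn using .inl hn.le
    · filter_upwards [ae_algMoment_two_eq_three hident (by omega) heq.symm] with ω hω
      filter_upwards [eventually_gt_atTop 0] with n hn
      have h34 : empMoment (fun i : Fin n => X i ω) 3 = empMoment (fun i : Fin n => X i ω) 4 := by
        simp only [empMoment, algMoment_three_eq_four _ hK (hω _)]
      refine .inr ⟨by simp only [empMoment, hω], by simp only [hw, h34],
        (hwilson _ (by omega) hn).2.2⟩
  -- the quadratic defining `u` is nonpositive at `μ̂₂`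
  have hquad : ∀ᵐ ω ∂P, ∀ᶠ n : ℕ in atTop,
      (n + 2 * z * (2 * k - 3) / (k * (k - 1))) * empMoment (fun i : Fin n => X i ω) 2 ^ 2 -
        (2 * n * empMoment (fun i : Fin n => X i ω) 2 + 2 * z / (k * (k - 1))) *
          empMoment (fun i : Fin n => X i ω) 2 +
        (n * empMoment (fun i : Fin n => X i ω) 2 ^ 2 - d n (fun i : Fin n => X i ω) * z) ≤ 0 := by
    filter_upwards [hcase] with ω hω
    filter_upwards [hω, eventually_gt_atTop 0] with n hn hpos
    have h := mul_nonneg hz0 (fourthOrder_variance_nonneg hk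
      (empMoment_nonneg (fun i : Fin n => X i ω) (by omega) (by omega))
      (empMoment_le_one (fun i : Fin n => X i ω) (by omega) (by omega))
      (empMoment_two_sq_le (fun i : Fin n => X i ω) hK)
      (empMoment_nonneg (fun i : Fin n => X i ω) (by omega) (by omega))
      (hwilson (fun i : Fin n => X i ω) (by omega : 3 ≤ K) hpos).2.1
      (hwilson (fun i : Fin n => X i ω) hK hpos).2.1 hn)
    refine le_of_eq_of_le ?_ (neg_nonpos.2 h)
    simp only [hd, hw]
    ring
  have hlead : ∀ {n : ℕ}, 0 < n → 0 < (n : ℝ) + 2 * z * (2 * k - 3) / (k * (k - 1)) := by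
    intro n hn
    have hn' : (0 : ℝ) < n := by exact_mod_cast hn
    have : 0 ≤ 2 * z * (2 * k - 3) / (k * (k - 1)) :=
      div_nonneg (mul_nonneg (by linarith) (by linarith)) hden.le
    linarith
  refine asymptoticallyValid_of_finalStep hX hident hindep (by omega) (γ := β / 4) u
    (by linarith) (by linarith) (by linarith) (by linarith) hulim ?_ ?_
  · filter_upwards [hquad] with ω hω
    filter_upwards [hω, eventually_gt_atTop 0] with n hn hpos using le_largerRoot (hlead hpos) hn
  · filter_upwards [hquad] with ω hω
    filter_upwards [hω, eventually_gt_atTop 0] with n hn hpos L U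
    have h3 := (hwilson (fun i : Fin n => X i ω) (by omega : 3 ≤ K) hpos).1
    have h4 := (hwilson (fun i : Fin n => X i ω) hK hpos).1
    have h2 := fun r => isLargerRoot_iff_eq (r := r) (hlead hpos) hn
    simp only [FourthOrderOutput, ← hz]
    constructor
    · rintro ⟨u₂, u₃, u₄, hu₃, hu₄, hu₂, hfin⟩
      obtain rfl := (h3 u₃).1 hu₃
      obtain rfl := (h4 u₄).1 hu₄
      obtain rfl := (h2 u₂).1 hu₂
      exact hfin
    · exact fun hfin => ⟨_, _, _, (h3 _).2 rfl, (h4 _).2 rfl, (h2 _).2 rfl, hfin⟩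

end Intervals

end Wilson

end

theorem mainTheorem7 {Ω : Type*} [MeasurableSpace Ω] (P : Measure Ω) [IsProbabilityMeasure P]
    (K : ℕ) (m : ℕ → ℝ) (X : ℕ → Ω → Fin K → Fin 2)
    (hX : ∀ i, Wilson.IsXBern P (X i) m)
    (hident : ∀ i, IdentDistrib (X i) (X 0) P P)
    (hindep : iIndepFun X P)
    (β : ℝ) (hβ0 : 0 < β) (hβ1 : β < 1) :
    (1 ≤ K → Wilson.AsymptoticallyValid P X
      (fun _ x L U => Wilson.FirstOrderOutput β x L U) (m 1) β 2) ∧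
    (2 ≤ K → Wilson.AsymptoticallyValid P X
      (fun _ x L U => Wilson.SecondOrderOutput β x L U) (m 1) β (3 / 2)) ∧
    (4 ≤ K → Wilson.AsymptoticallyValid P X
      (fun _ x L U => Wilson.FourthOrderOutput β x L U) (m 1) β (5 / 4)) := by
  have hmeas : ∀ i, AEMeasurable (X i) P := fun i => (hX i).aemeasurable
  have hmean : 1 ≤ K → ∫ ω, Wilson.sampleMean (X 0 ω) ∂P = m 1 := fun hK => by
    simpa only [Wilson.momentStat_one] using (hX 0).moments 1 (Finset.mem_Icc.2 ⟨le_rfl, hK⟩)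
  refine ⟨fun hK => ?_, fun hK => ?_, fun hK => ?_⟩
  · rw [← hmean hK]
    exact Wilson.asymptoticallyValid_firstOrder hmeas hident hindep hβ0 hβ1 (by omega)
  · rw [← hmean (by omega)]
    exact Wilson.asymptoticallyValid_secondOrder hmeas hident hindep hβ0 hβ1 hK
  · rw [← hmean (by omega)]
    exact Wilson.asymptoticallyValid_fourthOrder hmeas hident hindep hβ0 hβ1 hK
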